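/- Let $T_1<T_2$ and let $p,q,m,n\in C[T_1,T_2]$ with $p>0$ and $q\ge 0$ on $[T_1,T_2]$, $m\not\equiv0$ and $n\not\equiv0$. For $(a,b)\in\mathbb R^2$ consider the Neumann problem $$-(p u')'+q u = a\,m\,u^+-b\,n\,u^-\ \text{ in }\,]T_1,T_2[,\qquad u'(T_1)=0=u'(T_2),$$ where $u^\pm=\max\{\pm u,0\}$. For an integer $k\ge 0$ let $C_k^>$ (resp. $C_k^<$) be the set of all $(a,b)\in\mathbb R^2$ for which this problem has a nontrivial solution $u$ with exactly $k$ zeros in $]T_1,T_2[$ and $u(T_2)>0$ (resp. $u(T_2)<0$). For a sign $\epsilon\in\{+,-\}$ write $f^{\epsilon}=\max\{\epsilon f,0\}$ and $\mathbb R_\epsilon=\{x\in\mathbb R:\epsilon x\ge 0\}$. The bumps of $f^{\epsilon}$ are the connected components of $\{t\in[T_1,T_2]: f^{\epsilon}(t)>0\}$. Let $\epsilon_1,\epsilon_2\in\{+,-\}$. (1) If $m^{\epsilon_1}n^{\epsilon_2}\not\equiv 0$ on $[T_1,T_2]$, then for every $k\ge1$ both $C_k^>\cap(\mathbb R_{\epsilon_1}\times\mathbb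 R_{\epsilon_2})$ and $C_k^<\cap(\mathbb R_{\epsilon_1}\times\mathbb R_{\epsilon_2})$ are nonempty. (2) Suppose that $m^{\epsilon_1}$ or $n^{\epsilon_2}$ has only finitely many bumps. Then the converse of (1) holds: if for every $k\ge1$ both intersections are nonempty, then $m^{\epsilon_1}n^{\epsilon_2}\not\equiv0$ on $[T_1,T_2]$. More generally, it suffices that for infinitely many $k\ge1$ at least one of the two intersections is nonempty. -/

import Mathlib

open Set

/-- `u` is a solution on `[T₁, T₂]` of the Neumann problem
`-(p u')' + q u = a m u⁺ - b n u⁻` in `]T₁, T₂[`, `u'(T₁) = 0 = u'(T₂)`, in the classical sense: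
`u` is `C¹` on `[T₁, T₂]` and `p u'` is differentiable (hence `C¹`, by the equation).
The derivative of `u` is the one relative to `[T₁, T₂]`: one-sided at the end points,
two-sided inside. -/
structure IsNeumannSolution (T₁ T₂ : ℝ) (p q m n : ℝ → ℝ) (a b : ℝ) (u : ℝ → ℝ) : Prop where
  contDiffOn : ContDiffOn ℝ 1 u (Icc T₁ T₂)
  equation : ∀ t ∈ Ioo T₁ T₂,
    HasDerivAt (fun s => p s * derivWithin u (Icc T₁ T₂) s)
      (q t * u t - (a * m t * (u t)⁺ - b * n t * (u t)⁻)) t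
  left : derivWithin u (Icc T₁ T₂) T₁ = 0
  right : derivWithin u (Icc T₁ T₂) T₂ = 0

/-- `C_k^>`: the pairs `(a, b)` for which there is a (nontrivial) solution with exactly `k` zeros
in `]T₁, T₂[` and ending positively; such a solution is nontrivial because `u(T₂) > 0`. -/
def curveGT (T₁ T₂ : ℝ) (p q m n : ℝ → ℝ) (k : ℕ) : Set (ℝ × ℝ) :=
  {x | ∃ u : ℝ → ℝ, IsNeumannSolution T₁ T₂ p q m n x.1 x.2 u ∧
    {t ∈ Ioo T₁ T₂ | u t = 0}.encard = k ∧ 0 < u T₂}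

/-- `C_k^<`: the pairs `(a, b)` for which there is a (nontrivial) solution with exactly `k` zeros
in `]T₁, T₂[` and ending negatively. -/
def curveLT (T₁ T₂ : ℝ) (p q m n : ℝ → ℝ) (k : ℕ) : Set (ℝ × ℝ) :=
  {x | ∃ u : ℝ → ℝ, IsNeumannSolution T₁ T₂ p q m n x.1 x.2 u ∧
    {t ∈ Ioo T₁ T₂ | u t = 0}.encard = k ∧ u T₂ < 0}

/-- The half-line `ℝ_ε`, for a sign `ε = ±1`: `[0, ∞[` or `]-∞, 0]`. -/
def halfLine (ε : ℤˣ) : Set ℝ := {x | 0 ≤ ((ε : ℤ) : ℝ) * x}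

/-- The quadrant `ℝ_{ε₁} × ℝ_{ε₂}`. -/
def quadrant (ε₁ ε₂ : ℤˣ) : Set (ℝ × ℝ) := halfLine ε₁ ×ˢ halfLine ε₂

/-- The positive part (`ε = 1`) or negative part (`ε = -1`) `f^ε = max (ε f) 0` of `f`. -/
def signPart (ε : ℤˣ) (f : ℝ → ℝ) : ℝ → ℝ := fun t => (((ε : ℤ) : ℝ) * f t)⁺

/-- The bumps on `[T₁, T₂]` of a nonnegative function `g`: the connected components of
`{t ∈ [T₁, T₂] : g t > 0}`, that is, the maximal intervals on which `g` is positive. -/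
def bumps (T₁ T₂ : ℝ) (g : ℝ → ℝ) : Set (Set ℝ) :=
  connectedComponentIn {t ∈ Icc T₁ T₂ | 0 < g t} '' {t ∈ Icc T₁ T₂ | 0 < g t}

/-! Part (1) is a shooting argument on a ray. Replacing m, n by ε₁m, ε₂n and taking (a, b) = (ε₁c,
ε₂c) with c ≥ 0, one may assume that both weights are positive at a common point, hence on a
subinterval. The substitution u = ρ sin θ, p u' = ρ cos θ gives an equation for θ alone, and the
Neumann conditions become cos θ = 0 at both ends. Where sin θ = 0 one has θ' = 1/p > 0, so each
multiple of π is crossed only upwards, and an angle running from π/2 + jπ to π/2 + (j + k)π gives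
exactly k zeros. The terminal angle is continuous in c (`continuous_terminal_angle`), gains at most
π for c = 0 (`IsPruferAngle.terminal_le_of_zero`) and as much as desired for a suitable c
(`exists_large_growth`). The intermediate value theorem yields every k ≥ 1; the choice of j fixes
the sign at T₂.

Part (2) is a Sturm-type count. Between consecutive zeros, a m is positive somewhere if u > 0, and b
n if u < 0: otherwise p |u|' would be nondecreasing there, although |u| rises and then falls. Zeros
are simple, so these points alternate (`IsNeumannSolution.exists_chain`). If m^ε₁ n^ε₂ ≡ 0, points
of one kind separate the bumps containing points of the other kind, so finitely many bumps of either
factor bound the number of zeros (`IsNeumannSolution.zeros_le`). -/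

/-! ### Sign and uniqueness lemmas for (p u')' = h u -/

/-- Between two zeros of a solution of `(p u')' = h u` that is positive in between, `h` takes a
negative value. -/
theorem exists_neg_potential_of_pos_between_zeros {p u D h : ℝ → ℝ} {x y : ℝ} (hxy : x < y)
    (hp : ∀ t ∈ Ioo x y, 0 < p t) (hc : ContinuousOn u (Icc x y))
    (hu : ∀ t ∈ Ioo x y, HasDerivAt u (D t) t)
    (hv : ∀ t ∈ Ioo x y, HasDerivAt (fun s => p s * D s) (h t * u t) t)
    (hpos : ∀ t ∈ Ioo x y, 0 < u t) (hx : u x = 0) (hy : u y = 0) :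
    ∃ t ∈ Ioo x y, h t < 0 := by
  by_contra! hcon
  obtain ⟨s, hs⟩ : (Ioo x y).Nonempty := nonempty_Ioo.2 hxy
  -- The mean value theorem on either side of `s` gives a positive slope and then a negative one,
  -- whereas `h ≥ 0` makes `p D` nondecreasing.
  obtain ⟨c, hc1, hc2⟩ := exists_hasDerivAt_eq_slope u D hs.1
    (hc.mono (Icc_subset_Icc le_rfl hs.2.le)) (fun t ht => hu t ⟨ht.1, ht.2.trans hs.2⟩)
  obtain ⟨d, hd1, hd2⟩ := exists_hasDerivAt_eq_slope u D hs.2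
    (hc.mono (Icc_subset_Icc hs.1.le le_rfl)) (fun t ht => hu t ⟨hs.1.trans ht.1, ht.2⟩)
  have hcm : c ∈ Ioo x y := ⟨hc1.1, hc1.2.trans hs.2⟩
  have hdm : d ∈ Ioo x y := ⟨hs.1.trans hd1.1, hd1.2⟩
  have hDc : 0 < D c := by
    rw [hc2, hx]; exact div_pos (by linarith [hpos s hs]) (by linarith [hs.1])
  have hDd : D d < 0 := by
    rw [hd2, hy]; exact div_neg_of_neg_of_pos (by linarith [hpos s hs]) (by linarith [hs.2])
  have hmono : MonotoneOn (fun s => p s * D s) (Ioo x y) := by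
    apply monotoneOn_of_deriv_nonneg (convex_Ioo x y)
    · exact fun t ht => (hv t ht).continuousAt.continuousWithinAt
    · intro t ht
      rw [interior_Ioo] at ht
      exact (hv t ht).differentiableAt.differentiableWithinAt
    · intro t ht
      rw [interior_Ioo] at ht
      rw [(hv t ht).deriv]
      exact mul_nonneg (hcon t ht) (hpos t ht).le
  have h1 := hmono hcm hdm (hc1.2.trans hd1.1).le
  have h2 := mul_pos (hp c hcm) hDc
  have h3 := mul_neg_of_pos_of_neg (hp d hdm) hDd
  simp only at h1
  linarith

/-- A continuous function without zeros on an open interval has constant sign there. -/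
theorem pos_or_neg_of_ne_zero_on_Ioo {u : ℝ → ℝ} {x y : ℝ} (hc : ContinuousOn u (Ioo x y))
    (h0 : ∀ t ∈ Ioo x y, u t ≠ 0) :
    (∀ t ∈ Ioo x y, 0 < u t) ∨ (∀ t ∈ Ioo x y, u t < 0) := by
  by_contra! hcon
  obtain ⟨⟨s, hs, hs0⟩, r, hr, hr0⟩ := hcon
  obtain ⟨t, ht, ht0⟩ := isPreconnected_Ioo.intermediate_value hs hr hc ⟨hs0, hr0⟩
  exact h0 t ht ht0

/-- Forward uniqueness of the zero solution of the linear inequality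
`|(p u')'| ≤ C |u|`. -/
theorem eq_zero_of_zero_initial_data {p u D V : ℝ → ℝ} {x y K L : ℝ}
    (hp : ∀ t ∈ Icc x y, 0 < p t) (hK : ∀ t ∈ Icc x y, (p t)⁻¹ ≤ K)
    (hu : ∀ t ∈ Icc x y, HasDerivAt u (D t) t)
    (hv : ∀ t ∈ Icc x y, HasDerivAt (fun s => p s * D s) (V t) t)
    (hV : ∀ t ∈ Icc x y, |V t| ≤ L * |u t|) (hx : u x = 0) (hDx : D x = 0) :
    ∀ t ∈ Icc x y, u t = 0 := by
  intro t ht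
  have hder : ∀ t ∈ Icc x y,
      HasDerivAt (fun s => (u s, p s * D s)) (D t, V t) t := fun t ht =>
    (hu t ht).prodMk (hv t ht)
  -- Grönwall for the first-order system of `(u, p D)` in the sup norm: `|D| ≤ K |p D|` and `|V| ≤ L
  -- |u|`.
  have := eq_zero_of_abs_deriv_le_mul_abs_self_of_eq_zero_right (K := max K L)
    (f := fun s => (u s, p s * D s)) (f' := fun s => (D s, V s)) (a := x) (b := y)
    (fun t ht => (hder t ht).continuousAt.continuousWithinAt)
    (fun t ht => (hder t (Ico_subset_Icc_self ht)).hasDerivWithinAt)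
    (by simp [hx, hDx]) ?_ t ht
  · simpa using congrArg Prod.fst this
  · intro s hs
    have hs' := Ico_subset_Icc_self hs
    have hps := hp s hs'
    have hK0 : 0 ≤ K := (inv_pos.2 hps).le.trans (hK s hs')
    simp only [Prod.norm_def, Real.norm_eq_abs]
    apply max_le
    · have : |D s| = (p s)⁻¹ * |p s * D s| := by
        rw [abs_mul, abs_of_pos hps]; field_simp
      rw [this]
      exact mul_le_mul ((hK s hs').trans (le_max_left _ _)) (le_max_right _ _) (abs_nonneg _)
        (hK0.trans (le_max_left _ _))
    · refine (hV s hs').trans ?_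
      exact mul_le_mul (le_max_right _ _) (le_max_left _ _) (abs_nonneg _)
        (hK0.trans (le_max_left _ _))

/-! ### Counting bumps by alternating chains -/

/-- `K` points of positivity of `g` separated by points where `g` vanishes lie in distinct
bumps. -/
theorem le_ncard_bumps {T₁ T₂ : ℝ} {g : ℝ → ℝ} (hfin : (bumps T₁ T₂ g).Finite) {K : ℕ}
    {s r : ℕ → ℝ} (hs : ∀ i < K, s i ∈ Icc T₁ T₂ ∧ 0 < g (s i)) (hr : ∀ i < K, ¬ 0 < g (r i))
    (hsr : ∀ i < K, s i < r i) (hrs : ∀ i j, i < j → j < K → r i < s j) :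
    K ≤ (bumps T₁ T₂ g).ncard := by
  set S := {t ∈ Icc T₁ T₂ | 0 < g t}
  have hne : ∀ i j, i < j → j < K →
      connectedComponentIn S (s i) ≠ connectedComponentIn S (s j) := by
    intro i j hij hj heq
    have hi := hij.trans hj
    have h1 : s i ∈ connectedComponentIn S (s j) := by
      rw [← heq]; exact mem_connectedComponentIn (hs i hi)
    have h2 : s j ∈ connectedComponentIn S (s j) := mem_connectedComponentIn (hs j hj)
    -- A bump containing both `s i` and `s j` would also contain `r i`, which lies between them.
    have h3 := isPreconnected_connectedComponentIn.Icc_subset h1 h2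
      ⟨(hsr i hi).le, (hrs i j hij hj).le⟩
    exact hr i hi (connectedComponentIn_subset _ _ h3).2
  have hinj : InjOn (fun i => connectedComponentIn S (s i)) (Finset.range K : Set ℕ) := by
    intro i hi j hj hij
    simp only [Finset.coe_range, mem_Iio] at hi hj
    rcases lt_trichotomy i j with h | h | h
    · exact absurd hij (hne i j h hj)
    · exact h
    · exact absurd hij.symm (hne j i h hi)
  have := hinj.ncard_image
  rw [ncard_coe_finset, Finset.card_range] at this
  rw [← this]
  refine ncard_le_ncard ?_ hfin
  rintro _ ⟨i, hi, rfl⟩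
  simp only [Finset.coe_range, mem_Iio] at hi
  exact ⟨s i, hs i hi, rfl⟩

/-- An increasing chain of `N` points, alternately points of `P` and points of `Q`. -/
def IsAlternatingChain (P Q : ℝ → Prop) (N : ℕ) (x : ℕ → ℝ) : Prop :=
  (∀ i j, i < j → j < N → x i < x j) ∧ ∀ i < N, (Even i → P (x i)) ∧ (¬ Even i → Q (x i))

/-- Dropping the first point lets the count start with the other predicate, at the cost of one
point. -/
theorem IsAlternatingChain.shift {P Q : ℝ → Prop} {N : ℕ} {x : ℕ → ℝ}
    (h : IsAlternatingChain P Q (N + 1) x) : IsAlternatingChain Q P N (fun i => x (i + 1)) := by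
  refine ⟨fun i j hij hj => h.1 _ _ (by omega) (by omega), fun i hi => ?_⟩
  have := h.2 (i + 1) (by omega)
  rw [Nat.even_add_one, not_not] at this
  exact ⟨this.2, this.1⟩

/-- Points are grouped in pairs: the odd one of each pair separates the bump of its predecessor from
all later ones. -/
theorem IsAlternatingChain.le_ncard_bumps {T₁ T₂ : ℝ} {g : ℝ → ℝ}
    (hfin : (bumps T₁ T₂ g).Finite) {P Q : ℝ → Prop} {K : ℕ} {x : ℕ → ℝ}
    (h : IsAlternatingChain P Q (2 * K) x)
    (hP : ∀ t, P t → t ∈ Icc T₁ T₂ ∧ 0 < g t) (hQ : ∀ t, Q t → ¬ 0 < g t) :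
    K ≤ (bumps T₁ T₂ g).ncard := by
  refine _root_.le_ncard_bumps hfin (s := fun i => x (2 * i)) (r := fun i => x (2 * i + 1))
    ?_ ?_ ?_ ?_
  · exact fun i hi => hP _ ((h.2 (2 * i) (by omega)).1 (by simp))
  · exact fun i hi => hQ _ ((h.2 (2 * i + 1) (by omega)).2 (by simp))
  · exact fun i hi => h.1 _ _ (by omega) (by omega)
  · exact fun i j hij hj => h.1 _ _ (by omega) (by omega)

/-- This is where the quadrant enters: `a` has the sign `ε` or is zero, so the effective weight can
be positive only on the bumps of `f^ε`. -/
theorem signPart_pos_of_mul_pos {ε : ℤˣ} {a : ℝ} {f : ℝ → ℝ} {t : ℝ} (ha : a ∈ halfLine ε)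
    (h : 0 < a * f t) : 0 < signPart ε f t := by
  have ha' : 0 ≤ ((ε : ℤ) : ℝ) * a := ha
  rw [signPart, posPart_pos_iff]
  rcases Int.units_eq_one_or ε with rfl | rfl
  · simp only [Units.val_one, Int.cast_one, one_mul] at ha' ⊢
    exact pos_of_mul_pos_right h ha'
  · simp only [Units.val_neg, Units.val_one, Int.cast_neg, Int.cast_one] at ha' ⊢
    nlinarith

/-! ### Nodal intervals and the bound on the number of zeros -/

section nodal
variable {T₁ T₂ : ℝ} {p q m n : ℝ → ℝ} {a b : ℝ} {u : ℝ → ℝ}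

theorem IsNeumannSolution.hasDerivAt (h : IsNeumannSolution T₁ T₂ p q m n a b u) {t : ℝ}
    (ht : t ∈ Ioo T₁ T₂) : HasDerivAt u (derivWithin u (Icc T₁ T₂) t) t :=
  ((h.contDiffOn.differentiableOn one_ne_zero t
    (Ioo_subset_Icc_self ht)).hasDerivWithinAt).hasDerivAt (Icc_mem_nhds ht.1 ht.2)

/-- The reflection `u ↦ -u` exchanges the two weights. -/
theorem IsNeumannSolution.neg (h : IsNeumannSolution T₁ T₂ p q m n a b u) :
    IsNeumannSolution T₁ T₂ p q n m b a (-u) where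
  contDiffOn := h.contDiffOn.neg
  equation t ht := by
    have h1 := (h.equation t ht).neg
    have h2 : (fun s => p s * derivWithin (-u) (Icc T₁ T₂) s)
        = -(fun s => p s * derivWithin u (Icc T₁ T₂) s) := by
      funext s; simp [derivWithin.neg]
    rw [h2]
    refine h1.congr_deriv ?_
    rw [Pi.neg_apply, negPart_neg, posPart_neg]
    ring
  left := by rw [derivWithin.neg, h.left, neg_zero]
  right := by rw [derivWithin.neg, h.right, neg_zero]

/-- On a nodal interval where the solution is positive, `a m` takes a positive value. -/
theorem IsNeumannSolution.exists_weight_pos (h : IsNeumannSolution T₁ T₂ p q m n a b u)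
    (hp : ∀ t ∈ Icc T₁ T₂, 0 < p t) (hq : ∀ t ∈ Icc T₁ T₂, 0 ≤ q t)
    {x y : ℝ} (hxy : x < y) (hx : x ∈ Ioo T₁ T₂) (hy : y ∈ Ioo T₁ T₂) (hux : u x = 0)
    (huy : u y = 0) (hpos : ∀ t ∈ Ioo x y, 0 < u t) :
    ∃ t ∈ Ioo x y, 0 < a * m t := by
  have hsub : Icc x y ⊆ Ioo T₁ T₂ := fun t ht => ⟨hx.1.trans_le ht.1, ht.2.trans_lt hy.2⟩
  have hsub' := Ioo_subset_Icc_self.trans hsub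
  obtain ⟨t, ht, hneg⟩ := exists_neg_potential_of_pos_between_zeros
    (h := fun t => q t - a * m t) hxy
    (fun t ht => hp t (Ioo_subset_Icc_self (hsub' ht)))
    (fun t ht => (h.hasDerivAt (hsub ht)).continuousAt.continuousWithinAt)
    (fun t ht => h.hasDerivAt (hsub' ht))
    (fun t ht => by
      convert h.equation t (hsub' ht) using 1
      rw [posPart_of_nonneg (hpos t ht).le, negPart_of_nonneg (hpos t ht).le]
      ring) hpos hux huy
  exact ⟨t, ht, by linarith [hq t (Ioo_subset_Icc_self (hsub' ht))]⟩

/-- A solution with finitely many interior zeros has only simple zeros. -/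
theorem IsNeumannSolution.deriv_ne_zero (h : IsNeumannSolution T₁ T₂ p q m n a b u)
    (hpc : ContinuousOn p (Icc T₁ T₂)) (hqc : ContinuousOn q (Icc T₁ T₂))
    (hmc : ContinuousOn m (Icc T₁ T₂)) (hnc : ContinuousOn n (Icc T₁ T₂))
    (hp : ∀ t ∈ Icc T₁ T₂, 0 < p t) (hfin : {t ∈ Ioo T₁ T₂ | u t = 0}.Finite)
    {x : ℝ} (hx : x ∈ Ioo T₁ T₂) (hux : u x = 0) : derivWithin u (Icc T₁ T₂) x ≠ 0 := by
  intro hD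
  obtain ⟨K, hK⟩ := isCompact_Icc.exists_bound_of_continuousOn
    (hpc.inv₀ fun t ht => (hp t ht).ne')
  obtain ⟨L, hL⟩ := isCompact_Icc.exists_bound_of_continuousOn
    (hqc.abs.add ((hmc.const_smul a).abs.add (hnc.const_smul b).abs))
  -- Forward uniqueness makes `u` vanish on all of `[x, y]`, against the finiteness of the zero set.
  -- Taking `y < T₂` keeps the derivatives two-sided.
  obtain ⟨y, hxy, hy⟩ := exists_between hx.2
  have hsub : Icc x y ⊆ Ioo T₁ T₂ := fun t ht => ⟨hx.1.trans_le ht.1, ht.2.trans_lt hy⟩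
  have hsub' := hsub.trans Ioo_subset_Icc_self
  have hz : ∀ t ∈ Icc x y, u t = 0 := by
    refine eq_zero_of_zero_initial_data (K := K) (L := L) (fun t ht => hp t (hsub' ht))
      (fun t ht => (le_abs_self _).trans (hK t (hsub' ht))) (fun t ht => h.hasDerivAt (hsub ht))
      (fun t ht => h.equation t (hsub ht)) (fun t ht => ?_) hux hD
    have h1 : |q t| + (|a * m t| + |b * n t|) ≤ L := (le_abs_self _).trans (hL t (hsub' ht))
    refine le_trans ?_ (mul_le_mul_of_nonneg_right h1 (abs_nonneg _))
    have e1 : |(u t)⁺| ≤ |u t| := by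
      rw [abs_of_nonneg (posPart_nonneg _)]; exact sup_le (le_abs_self _) (abs_nonneg _)
    have e2 : |(u t)⁻| ≤ |u t| := by
      rw [abs_of_nonneg (negPart_nonneg _)]; exact sup_le (neg_le_abs _) (abs_nonneg _)
    calc |q t * u t - (a * m t * (u t)⁺ - b * n t * (u t)⁻)|
        ≤ |q t * u t| + (|a * m t * (u t)⁺| + |b * n t * (u t)⁻|) :=
          (abs_sub _ _).trans (add_le_add le_rfl (abs_sub _ _))
      _ = |q t| * |u t| + (|a * m t| * |(u t)⁺| + |b * n t| * |(u t)⁻|) := by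
          simp only [abs_mul]
      _ ≤ |q t| * |u t| + (|a * m t| * |u t| + |b * n t| * |u t|) := by gcongr
      _ = _ := by ring
  exact (Icc_infinite hxy) (hfin.subset fun t ht => ⟨hsub ht, hz t ht⟩)

/-- Two adjacent nodal intervals of a solution with finitely many interior zeros cannot both be
positive. -/
theorem IsNeumannSolution.not_pos_pos (h : IsNeumannSolution T₁ T₂ p q m n a b u)
    (hpc : ContinuousOn p (Icc T₁ T₂)) (hqc : ContinuousOn q (Icc T₁ T₂))
    (hmc : ContinuousOn m (Icc T₁ T₂)) (hnc : ContinuousOn n (Icc T₁ T₂))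
    (hp : ∀ t ∈ Icc T₁ T₂, 0 < p t) (hfin : {t ∈ Ioo T₁ T₂ | u t = 0}.Finite)
    {x y z : ℝ} (hxy : x < y) (hyz : y < z) (hy : y ∈ Ioo T₁ T₂) (huy : u y = 0)
    (h1 : ∀ t ∈ Ioo x y, 0 < u t) (h2 : ∀ t ∈ Ioo y z, 0 < u t) : False := by
  -- Positivity on both sides would make `y` a local minimum, hence a double zero.
  refine h.deriv_ne_zero hpc hqc hmc hnc hp hfin hy huy
    (IsLocalMin.hasDerivAt_eq_zero ?_ (h.hasDerivAt hy))
  filter_upwards [Ioo_mem_nhds hxy hyz] with t ht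
  rw [huy]
  rcases lt_trichotomy t y with h | h | h
  · exact (h1 t ⟨ht.1, h⟩).le
  · rw [h, huy]
  · exact (h2 t ⟨h, ht.2⟩).le

/-- From a solution with `N + 1` zeros we get a chain of `N` points at which alternately `a m` and
`b n` are positive. -/
theorem IsNeumannSolution.exists_chain (h : IsNeumannSolution T₁ T₂ p q m n a b u)
    (hpc : ContinuousOn p (Icc T₁ T₂)) (hqc : ContinuousOn q (Icc T₁ T₂))
    (hmc : ContinuousOn m (Icc T₁ T₂)) (hnc : ContinuousOn n (Icc T₁ T₂))
    (hp : ∀ t ∈ Icc T₁ T₂, 0 < p t) (hq : ∀ t ∈ Icc T₁ T₂, 0 ≤ q t) {N : ℕ}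
    (hN : {t ∈ Ioo T₁ T₂ | u t = 0}.encard = (N + 1 : ℕ)) :
    ∃ x, IsAlternatingChain (fun t => t ∈ Icc T₁ T₂ ∧ 0 < a * m t)
        (fun t => t ∈ Icc T₁ T₂ ∧ 0 < b * n t) N x ∨
      IsAlternatingChain (fun t => t ∈ Icc T₁ T₂ ∧ 0 < b * n t)
        (fun t => t ∈ Icc T₁ T₂ ∧ 0 < a * m t) N x := by
  have hfin : {t ∈ Ioo T₁ T₂ | u t = 0}.Finite := finite_of_encard_eq_coe hN
  have hcard : hfin.toFinset.card = N + 1 := by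
    rw [hfin.encard_eq_coe_toFinset_card] at hN
    exact_mod_cast hN
  set e := hfin.toFinset.orderEmbOfFin hcard
  have hrange : ∀ t, t ∈ Ioo T₁ T₂ → u t = 0 → ∃ i, e i = t := by
    intro t ht h0
    have : t ∈ range e := by
      rw [Finset.range_orderEmbOfFin]; simp [ht.1, ht.2, h0]
    exact this
  have hmem : ∀ i, e i ∈ Ioo T₁ T₂ ∧ u (e i) = 0 := by
    intro i
    have := Finset.orderEmbOfFin_mem hfin.toFinset hcard i
    exact hfin.mem_toFinset.1 this
  -- The zeros in increasing order; the value 0 beyond index `N` is never used. Only the `N` gaps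
  -- between interior zeros matter, since the sign lemma needs a zero at both ends.
  set z : ℕ → ℝ := fun i => if hi : i < N + 1 then e ⟨i, hi⟩ else 0 with hzdef
  have hz : ∀ i (hi : i < N + 1), z i = e ⟨i, hi⟩ := fun i hi => dif_pos hi
  have hzm : ∀ i < N + 1, z i ∈ Ioo T₁ T₂ ∧ u (z i) = 0 := fun i hi => by
    rw [hz i hi]; exact hmem _
  have hzlt : ∀ i j, i < j → j < N + 1 → z i < z j := fun i j hij hj => by
    rw [hz i (hij.trans hj), hz j hj]; exact e.strictMono hij
  have hsub : ∀ i < N, Ioo (z i) (z (i + 1)) ⊆ Ioo T₁ T₂ := fun i hi t ht =>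
    ⟨(hzm i (by omega)).1.1.trans ht.1, ht.2.trans (hzm (i + 1) (by omega)).1.2⟩
  have hne : ∀ i < N, ∀ t ∈ Ioo (z i) (z (i + 1)), u t ≠ 0 := by
    intro i hi t ht h0
    obtain ⟨⟨j, hj⟩, hjt⟩ := hrange t (hsub i hi ht) h0
    rw [← hz j hj] at hjt
    subst hjt
    rcases lt_or_ge i j with hij | hij
    · rcases (show j = i + 1 ∨ i + 1 < j by omega) with rfl | hij'
      · exact lt_irrefl _ ht.2
      · exact lt_asymm ht.2 (hzlt _ _ hij' hj)
    · rcases hij.eq_or_lt with rfl | hij'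
      · exact lt_irrefl _ ht.1
      · exact lt_asymm ht.1 (hzlt _ _ hij' (by omega))
  have hsign : ∀ i < N, (∀ t ∈ Ioo (z i) (z (i + 1)), 0 < u t) ∨
      (∀ t ∈ Ioo (z i) (z (i + 1)), u t < 0) := fun i hi =>
    pos_or_neg_of_ne_zero_on_Ioo
      (fun t ht => (h.hasDerivAt (hsub i hi ht)).continuousAt.continuousWithinAt) (hne i hi)
  have hfin' : {t ∈ Ioo T₁ T₂ | (-u) t = 0}.Finite := by simpa using hfin
  have hPN : ∀ i, i + 1 < N → (∀ t ∈ Ioo (z i) (z (i + 1)), 0 < u t) →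
      ∀ t ∈ Ioo (z (i + 1)) (z (i + 1 + 1)), u t < 0 := fun i hi hP =>
    (hsign (i + 1) hi).resolve_left fun hP' =>
      h.not_pos_pos hpc hqc hmc hnc hp hfin (hzlt i (i + 1) (by omega) (by omega))
        (hzlt (i + 1) (i + 1 + 1) (by omega) (by omega)) (hzm (i + 1) (by omega)).1
        (hzm (i + 1) (by omega)).2 hP hP'
  have hNP : ∀ i, i + 1 < N → (∀ t ∈ Ioo (z i) (z (i + 1)), u t < 0) →
      ∀ t ∈ Ioo (z (i + 1)) (z (i + 1 + 1)), 0 < u t := fun i hi hP =>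
    (hsign (i + 1) hi).resolve_right fun hP' =>
      h.neg.not_pos_pos hpc hqc hnc hmc hp hfin' (hzlt i (i + 1) (by omega) (by omega))
        (hzlt (i + 1) (i + 1 + 1) (by omega) (by omega)) (hzm (i + 1) (by omega)).1
        (by simp [(hzm (i + 1) (by omega)).2]) (fun t ht => neg_pos.2 (hP t ht))
        (fun t ht => neg_pos.2 (hP' t ht))
  have hwP : ∀ i < N, (∀ t ∈ Ioo (z i) (z (i + 1)), 0 < u t) →
      ∃ t ∈ Ioo (z i) (z (i + 1)), 0 < a * m t := fun i hi hP =>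
    h.exists_weight_pos hp hq (hzlt i (i + 1) (by omega) (by omega)) (hzm i (by omega)).1
      (hzm (i + 1) (by omega)).1 (hzm i (by omega)).2 (hzm (i + 1) (by omega)).2 hP
  have hwN : ∀ i < N, (∀ t ∈ Ioo (z i) (z (i + 1)), u t < 0) →
      ∃ t ∈ Ioo (z i) (z (i + 1)), 0 < b * n t := fun i hi hP =>
    h.neg.exists_weight_pos hp hq (hzlt i (i + 1) (by omega) (by omega)) (hzm i (by omega)).1
      (hzm (i + 1) (by omega)).1 (by simp [(hzm i (by omega)).2])
      (by simp [(hzm (i + 1) (by omega)).2]) (fun t ht => neg_pos.2 (hP t ht))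
  -- assemble a chain out of one point in each nodal interval
  have key : ∀ P Q : ℝ → Prop,
      (∀ i < N, (Even i → ∃ t ∈ Ioo (z i) (z (i + 1)), P t) ∧
        (¬ Even i → ∃ t ∈ Ioo (z i) (z (i + 1)), Q t)) →
      ∃ x, IsAlternatingChain (fun t => t ∈ Icc T₁ T₂ ∧ P t) (fun t => t ∈ Icc T₁ T₂ ∧ Q t) N x := by
    intro P Q hPQ
    have : ∀ i, ∃ t, i < N → t ∈ Ioo (z i) (z (i + 1)) ∧ (Even i → P t) ∧ (¬ Even i → Q t) := by
      intro i
      by_cases hi : i < N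
      · by_cases hev : Even i
        · obtain ⟨t, ht, hPt⟩ := (hPQ i hi).1 hev
          exact ⟨t, fun _ => ⟨ht, fun _ => hPt, fun h => absurd hev h⟩⟩
        · obtain ⟨t, ht, hPt⟩ := (hPQ i hi).2 hev
          exact ⟨t, fun _ => ⟨ht, fun h => absurd h hev, fun _ => hPt⟩⟩
      · exact ⟨0, fun h => absurd h hi⟩
    choose x hx using this
    refine ⟨x, fun i j hij hj => ?_, fun i hi => ?_⟩
    · refine (hx i (hij.trans hj)).1.2.trans_le (le_trans ?_ (hx j hj).1.1.le)
      rcases (show i + 1 = j ∨ i + 1 < j by omega) with rfl | h'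
      · exact le_rfl
      · exact (hzlt _ _ h' (by omega)).le
    · have hm := Ioo_subset_Icc_self (hsub i hi (hx i hi).1)
      exact ⟨fun he => ⟨hm, (hx i hi).2.1 he⟩, fun he => ⟨hm, (hx i hi).2.2 he⟩⟩
  rcases Nat.eq_zero_or_pos N with rfl | hN0
  · exact ⟨0, Or.inl ⟨fun i j _ hj => by omega, fun i hi => by omega⟩⟩
  rcases hsign 0 hN0 with h0 | h0
  · have hall : ∀ i < N, (Even i → ∀ t ∈ Ioo (z i) (z (i + 1)), 0 < u t) ∧
        (¬ Even i → ∀ t ∈ Ioo (z i) (z (i + 1)), u t < 0) := by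
      intro i
      induction i with
      | zero => exact fun _ => ⟨fun _ => h0, fun h => absurd Even.zero h⟩
      | succ i ih =>
        intro hi
        rw [Nat.even_add_one, not_not]
        exact ⟨fun he => hNP i hi ((ih (by omega)).2 he), fun he => hPN i hi ((ih (by omega)).1 he)⟩
    obtain ⟨x, hx⟩ := key (fun t => 0 < a * m t) (fun t => 0 < b * n t) fun i hi =>
      ⟨fun he => hwP i hi ((hall i hi).1 he), fun he => hwN i hi ((hall i hi).2 he)⟩
    exact ⟨x, Or.inl hx⟩
  · have hall : ∀ i < N, (Even i → ∀ t ∈ Ioo (z i) (z (i + 1)), u t < 0) ∧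
        (¬ Even i → ∀ t ∈ Ioo (z i) (z (i + 1)), 0 < u t) := by
      intro i
      induction i with
      | zero => exact fun _ => ⟨fun _ => h0, fun h => absurd Even.zero h⟩
      | succ i ih =>
        intro hi
        rw [Nat.even_add_one, not_not]
        exact ⟨fun he => hPN i hi ((ih (by omega)).2 he), fun he => hNP i hi ((ih (by omega)).1 he)⟩
    obtain ⟨x, hx⟩ := key (fun t => 0 < b * n t) (fun t => 0 < a * m t) fun i hi =>
      ⟨fun he => hwN i hi ((hall i hi).1 he), fun he => hwP i hi ((hall i hi).2 he)⟩
    exact ⟨x, Or.inr hx⟩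

/-- If `m^ε₁ n^ε₂ = 0` and one of the factors has finitely many bumps, the number of interior zeros
of solutions with `(a, b)` in the quadrant is bounded. -/
theorem IsNeumannSolution.zeros_le (h : IsNeumannSolution T₁ T₂ p q m n a b u)
    (hpc : ContinuousOn p (Icc T₁ T₂)) (hqc : ContinuousOn q (Icc T₁ T₂))
    (hmc : ContinuousOn m (Icc T₁ T₂)) (hnc : ContinuousOn n (Icc T₁ T₂))
    (hp : ∀ t ∈ Icc T₁ T₂, 0 < p t) (hq : ∀ t ∈ Icc T₁ T₂, 0 ≤ q t) {ε₁ ε₂ : ℤˣ}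
    (hab : (a, b) ∈ quadrant ε₁ ε₂)
    (hzero : ∀ t ∈ Icc T₁ T₂, signPart ε₁ m t * signPart ε₂ n t = 0)
    (hfin : (bumps T₁ T₂ (signPart ε₁ m)).Finite ∨ (bumps T₁ T₂ (signPart ε₂ n)).Finite) {k : ℕ}
    (hk : {t ∈ Ioo T₁ T₂ | u t = 0}.encard = k) :
    k < 2 * (bumps T₁ T₂ (signPart ε₁ m)).ncard + 2 * (bumps T₁ T₂ (signPart ε₂ n)).ncard + 4 := by
  by_contra! hlt
  have ha : a ∈ halfLine ε₁ := hab.1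
  have hb : b ∈ halfLine ε₂ := hab.2
  set A := (bumps T₁ T₂ (signPart ε₁ m)).ncard with hA
  set B := (bumps T₁ T₂ (signPart ε₂ n)).ncard with hB
  -- `N` exceeds both counts; an infinite family has `ncard` 0 and does no harm. A chain of `2 * N`
  -- points contradicts the finite count, and one more point is kept for a possible shift: `2 * N +
  -- 2` zeros in all.
  set N := A + B + 1 with hN
  obtain ⟨j, rfl⟩ : ∃ j, k = (2 * N + 1 + j) + 1 := ⟨k - (2 * N + 2), by omega⟩
  have hM : ∀ t, t ∈ Icc T₁ T₂ ∧ 0 < a * m t → t ∈ Icc T₁ T₂ ∧ 0 < signPart ε₁ m t :=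
    fun t ht => ⟨ht.1, signPart_pos_of_mul_pos ha ht.2⟩
  have hN' : ∀ t, t ∈ Icc T₁ T₂ ∧ 0 < b * n t → t ∈ Icc T₁ T₂ ∧ 0 < signPart ε₂ n t :=
    fun t ht => ⟨ht.1, signPart_pos_of_mul_pos hb ht.2⟩
  have hMN : ∀ t, t ∈ Icc T₁ T₂ ∧ 0 < b * n t → ¬ 0 < signPart ε₁ m t := fun t ht hpos =>
    (mul_pos hpos (hN' t ht).2).ne' (hzero t ht.1)
  have hNM : ∀ t, t ∈ Icc T₁ T₂ ∧ 0 < a * m t → ¬ 0 < signPart ε₂ n t := fun t ht hpos =>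
    (mul_pos (hM t ht).2 hpos).ne' (hzero t ht.1)
  have mono : ∀ {P Q : ℝ → Prop} {M M' : ℕ} {x : ℕ → ℝ}, M' ≤ M → IsAlternatingChain P Q M x →
      IsAlternatingChain P Q M' x := fun hle hc =>
    ⟨fun i j hij hj => hc.1 i j hij (by omega), fun i hi => hc.2 i (by omega)⟩
  obtain ⟨x, hx | hx⟩ := h.exists_chain hpc hqc hmc hnc hp hq hk <;>
  rcases hfin with hf | hf
  · have := (mono (M' := 2 * N) (by omega) hx).le_ncard_bumps hf hM hMN
    omega
  · have := (mono (M' := 2 * N + 1) (by omega) hx).shift.le_ncard_bumps hf hN' hNM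
    omega
  · have := (mono (M' := 2 * N + 1) (by omega) hx).shift.le_ncard_bumps hf hM hMN
    omega
  · have := (mono (M' := 2 * N) (by omega) hx).le_ncard_bumps hf hN' hNM
    omega

end nodal

/-! ### The Prüfer equation: estimates on the field -/

open Filter Topology

/-- The right-hand side of the equation of the Prüfer angle of
`-(p u')' + q u = c (m u⁺ - n u⁻)`. -/
noncomputable def pruferField (p q m n : ℝ → ℝ) (c t x : ℝ) : ℝ :=
  (p t)⁻¹ * Real.cos x ^ 2 - q t * Real.sin x ^ 2
    + c * (m t * (Real.sin x)⁺ ^ 2 + n t * (Real.sin x)⁻ ^ 2)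

/-- `θ` is a Prüfer angle on `[T₁, T₂]` for the parameter `c`. -/
def IsPruferAngle (T₁ T₂ : ℝ) (p q m n : ℝ → ℝ) (c : ℝ) (θ : ℝ → ℝ) : Prop :=
  ∀ t ∈ Icc T₁ T₂, HasDerivWithinAt θ (pruferField p q m n c t (θ t)) (Icc T₁ T₂) t

theorem abs_sq_sub_sq_le {x y d : ℝ} (hx : |x| ≤ 1) (hy : |y| ≤ 1) (h : |x - y| ≤ d) :
    |x ^ 2 - y ^ 2| ≤ 2 * d := by
  have h1 : |x + y| ≤ 2 := (abs_add_le x y).trans (by linarith)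
  rw [show x ^ 2 - y ^ 2 = (x + y) * (x - y) by ring, abs_mul]
  exact mul_le_mul h1 h (abs_nonneg _) zero_le_two

theorem abs_sin_sub_sin_le (x y : ℝ) : |Real.sin x - Real.sin y| ≤ |x - y| := by
  have := Real.lipschitzWith_sin.dist_le_mul x y
  simpa [Real.dist_eq] using this

theorem abs_cos_sub_cos_le (x y : ℝ) : |Real.cos x - Real.cos y| ≤ |x - y| := by
  have := Real.lipschitzWith_cos.dist_le_mul x y
  simpa [Real.dist_eq] using this

theorem abs_posPart_sin_le_one (x : ℝ) : |(Real.sin x)⁺| ≤ 1 := by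
  rw [abs_of_nonneg (posPart_nonneg _)]; exact sup_le (Real.sin_le_one x) zero_le_one

theorem abs_negPart_sin_le_one (x : ℝ) : |(Real.sin x)⁻| ≤ 1 := by
  rw [abs_of_nonneg (negPart_nonneg _)]
  exact sup_le (by linarith [Real.neg_one_le_sin x]) zero_le_one

section field
variable {p q m n : ℝ → ℝ} {C t : ℝ}

/-- Each of the four squares is 2-Lipschitz, as the square of a 1-Lipschitz function bounded by 1.
-/
theorem pruferField_lipschitz (hp : |(p t)⁻¹| ≤ C) (hq : |q t| ≤ C) (hm : |m t| ≤ C)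
    (hn : |n t| ≤ C) (c x y : ℝ) :
    |pruferField p q m n c t x - pruferField p q m n c t y| ≤ 4 * C * (1 + |c|) * |x - y| := by
  have hC : 0 ≤ C := (abs_nonneg _).trans hp
  have h1 := abs_sq_sub_sq_le (Real.abs_cos_le_one x) (Real.abs_cos_le_one y)
    (abs_cos_sub_cos_le x y)
  have h2 := abs_sq_sub_sq_le (Real.abs_sin_le_one x) (Real.abs_sin_le_one y)
    (abs_sin_sub_sin_le x y)
  have h3 := abs_sq_sub_sq_le (abs_posPart_sin_le_one x) (abs_posPart_sin_le_one y)
    ((abs_max_sub_max_le_abs (Real.sin x) (Real.sin y) 0).trans (abs_sin_sub_sin_le x y))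
  have h4 := abs_sq_sub_sq_le (abs_negPart_sin_le_one x) (abs_negPart_sin_le_one y)
    ((abs_max_sub_max_le_abs (-Real.sin x) (-Real.sin y) 0).trans
      ((neg_sub_neg (Real.sin x) (Real.sin y) ▸ abs_sub_comm (Real.sin y) (Real.sin x)).trans_le
        (abs_sin_sub_sin_le x y)))
  calc |pruferField p q m n c t x - pruferField p q m n c t y|
      = |(p t)⁻¹ * (Real.cos x ^ 2 - Real.cos y ^ 2) - q t * (Real.sin x ^ 2 - Real.sin y ^ 2)
        + c * (m t * ((Real.sin x)⁺ ^ 2 - (Real.sin y)⁺ ^ 2)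
          + n t * ((Real.sin x)⁻ ^ 2 - (Real.sin y)⁻ ^ 2))| := by
        rw [pruferField, pruferField]; congr 1; ring
    _ ≤ |(p t)⁻¹| * |Real.cos x ^ 2 - Real.cos y ^ 2| + |q t| * |Real.sin x ^ 2 - Real.sin y ^ 2|
        + |c| * (|m t| * |(Real.sin x)⁺ ^ 2 - (Real.sin y)⁺ ^ 2|
          + |n t| * |(Real.sin x)⁻ ^ 2 - (Real.sin y)⁻ ^ 2|) := by
        refine (abs_add_le _ _).trans (add_le_add ((abs_sub _ _).trans_eq ?_) ?_)
        · rw [abs_mul, abs_mul]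
        · rw [abs_mul c, ← abs_mul (m t), ← abs_mul (n t)]
          exact mul_le_mul_of_nonneg_left (abs_add_le _ _) (abs_nonneg _)
    _ ≤ C * (2 * |x - y|) + C * (2 * |x - y|)
        + |c| * (C * (2 * |x - y|) + C * (2 * |x - y|)) := by gcongr
    _ = 4 * C * (1 + |c|) * |x - y| := by ring

/-- The field is affine in the parameter. This is the error term in the Grönwall estimate for
continuous dependence on `c`. -/
theorem abs_pruferField_sub_le (hm : |m t| ≤ C) (hn : |n t| ≤ C) (c d x : ℝ) :
    |pruferField p q m n c t x - pruferField p q m n d t x| ≤ 2 * C * |c - d| := by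
  have hC : 0 ≤ C := (abs_nonneg _).trans hm
  have h3 : |(Real.sin x)⁺ ^ 2| ≤ 1 := by
    rw [abs_pow]; exact pow_le_one₀ (abs_nonneg _) (abs_posPart_sin_le_one x)
  have h4 : |(Real.sin x)⁻ ^ 2| ≤ 1 := by
    rw [abs_pow]; exact pow_le_one₀ (abs_nonneg _) (abs_negPart_sin_le_one x)
  calc |pruferField p q m n c t x - pruferField p q m n d t x|
      = |c - d| * |m t * (Real.sin x)⁺ ^ 2 + n t * (Real.sin x)⁻ ^ 2| := by
        rw [pruferField, pruferField, ← abs_mul]; ring_nf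
    _ ≤ |c - d| * (|m t| * |(Real.sin x)⁺ ^ 2| + |n t| * |(Real.sin x)⁻ ^ 2|) := by
        rw [← abs_mul (m t), ← abs_mul (n t)]
        exact mul_le_mul_of_nonneg_left (abs_add_le _ _) (abs_nonneg _)
    _ ≤ |c - d| * (C * 1 + C * 1) := by gcongr
    _ = _ := by ring

theorem abs_pruferField_le (hp : |(p t)⁻¹| ≤ C) (hq : |q t| ≤ C) (hm : |m t| ≤ C)
    (hn : |n t| ≤ C) (c x : ℝ) : |pruferField p q m n c t x| ≤ 2 * C * (1 + |c|) := by
  have hC : 0 ≤ C := (abs_nonneg _).trans hp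
  have h0 := abs_pruferField_sub_le (p := p) (q := q) hm hn c 0 x
  have h1 : |Real.cos x ^ 2| ≤ 1 := by
    rw [abs_pow]; exact pow_le_one₀ (abs_nonneg _) (Real.abs_cos_le_one x)
  have h2 : |Real.sin x ^ 2| ≤ 1 := by
    rw [abs_pow]; exact pow_le_one₀ (abs_nonneg _) (Real.abs_sin_le_one x)
  have h3 : |pruferField p q m n 0 t x| ≤ 2 * C := by
    calc |pruferField p q m n 0 t x|
        ≤ |(p t)⁻¹| * |Real.cos x ^ 2| + |q t| * |Real.sin x ^ 2| := by
          rw [pruferField, zero_mul, add_zero, ← abs_mul, ← abs_mul]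
          exact abs_sub _ _
      _ ≤ C * 1 + C * 1 := by gcongr
      _ = 2 * C := by ring
  rw [sub_zero] at h0
  have := abs_sub_abs_le_abs_sub (pruferField p q m n c t x) (pruferField p q m n 0 t x)
  linarith

/-- Here neither the weights nor `c` play a role, so for `p t > 0` the angle increases through
multiples of π even for weights of variable sign. -/
theorem pruferField_of_sin_eq_zero {c x : ℝ} (hx : Real.sin x = 0) :
    pruferField p q m n c t x = (p t)⁻¹ := by
  have := Real.sin_sq_add_cos_sq x
  rw [hx] at this
  have h : Real.cos x ^ 2 = 1 := by linarith
  simp [pruferField, hx, h]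

end field

/-! ### Prüfer angles: existence, zero count, growth, and the solution they define -/

section angle
variable {T₁ T₂ : ℝ} {p q m n : ℝ → ℝ} {c : ℝ} {θ : ℝ → ℝ}

theorem IsPruferAngle.continuousOn (h : IsPruferAngle T₁ T₂ p q m n c θ) :
    ContinuousOn θ (Icc T₁ T₂) := fun t ht => (h t ht).continuousWithinAt

theorem IsPruferAngle.hasDerivWithinAt_Ici (h : IsPruferAngle T₁ T₂ p q m n c θ) {t : ℝ}
    (ht : t ∈ Ico T₁ T₂) : HasDerivWithinAt θ (pruferField p q m n c t (θ t)) (Ici t) t :=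
  (h t (Ico_subset_Icc_self ht)).mono_of_mem_nhdsWithin (Icc_mem_nhdsGE_of_mem ht)

theorem exists_isPruferAngle (hT : T₁ ≤ T₂) (hp : ContinuousOn p (Icc T₁ T₂))
    (hq : ContinuousOn q (Icc T₁ T₂)) (hm : ContinuousOn m (Icc T₁ T₂))
    (hn : ContinuousOn n (Icc T₁ T₂)) (hp0 : ∀ t ∈ Icc T₁ T₂, 0 < p t) {C : ℝ}
    (hC : ∀ t ∈ Icc T₁ T₂, |(p t)⁻¹| ≤ C ∧ |q t| ≤ C ∧ |m t| ≤ C ∧ |n t| ≤ C) (c x₀ : ℝ) :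
    ∃ θ, θ T₁ = x₀ ∧ IsPruferAngle T₁ T₂ p q m n c θ := by
  have hC0 : 0 ≤ C := (abs_nonneg _).trans (hC T₁ (left_mem_Icc.2 hT)).1
  -- The bound `2 * C * (1 + |c|)` holds for all `x`, so the ball of radius bound times `T₂ - T₁` is
  -- not left in the available time and the solution exists on the whole interval.
  have hPL : IsPicardLindelof (pruferField p q m n c) (⟨T₁, left_mem_Icc.2 hT⟩ : Icc T₁ T₂) x₀
      (2 * C * (1 + |c|) * (T₂ - T₁)).toNNReal 0 (2 * C * (1 + |c|)).toNNReal
      (4 * C * (1 + |c|)).toNNReal := by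
    constructor
    · intro t ht
      refine LipschitzWith.lipschitzOnWith (LipschitzWith.of_dist_le_mul fun x y => ?_)
      rw [Real.coe_toNNReal _ (by positivity), Real.dist_eq, Real.dist_eq]
      obtain ⟨h1, h2, h3, h4⟩ := hC t ht
      exact pruferField_lipschitz h1 h2 h3 h4 c x y
    · intro x _
      exact (((hp.inv₀ fun t ht => (hp0 t ht).ne').mul continuousOn_const).sub
        (hq.mul continuousOn_const)).add (continuousOn_const.mul
          ((hm.mul continuousOn_const).add (hn.mul continuousOn_const)))
    · intro t ht x _
      rw [Real.coe_toNNReal _ (by positivity), Real.norm_eq_abs]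
      obtain ⟨h1, h2, h3, h4⟩ := hC t ht
      exact abs_pruferField_le h1 h2 h3 h4 c x
    · have : 0 ≤ T₂ - T₁ := by linarith
      rw [Real.coe_toNNReal _ (by positivity), Real.coe_toNNReal _ (by positivity)]
      simp [this]
  exact hPL.exists_eq_forall_mem_Icc_hasDerivWithinAt₀

/-- The terminal Prüfer angle depends continuously on the parameter. -/
theorem continuous_terminal_angle (hT : T₁ ≤ T₂) {C : ℝ}
    (hC : ∀ t ∈ Icc T₁ T₂, |(p t)⁻¹| ≤ C ∧ |q t| ≤ C ∧ |m t| ≤ C ∧ |n t| ≤ C) {x₀ : ℝ}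
    {Θ : ℝ → ℝ → ℝ} (h0 : ∀ c, Θ c T₁ = x₀) (hΘ : ∀ c, IsPruferAngle T₁ T₂ p q m n c (Θ c)) :
    Continuous fun c => Θ c T₂ := by
  have hC0 : 0 ≤ C := (abs_nonneg _).trans (hC T₁ (left_mem_Icc.2 hT)).1
  rw [continuous_iff_continuousAt]
  intro d
  -- `Θ c` solves the equation of `Θ d` up to an error `2 * C * |c - d|`, from the same initial
  -- value.
  have hdist : ∀ c, dist (Θ c T₂) (Θ d T₂) ≤
      gronwallBound 0 (4 * C * (1 + |d|)).toNNReal (2 * C * |c - d| + 0) (T₂ - T₁) := by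
    intro c
    refine dist_le_of_approx_trajectories_ODE_of_mem (v := pruferField p q m n d)
      (s := fun _ => univ) (f' := fun t => pruferField p q m n c t (Θ c t))
      (g' := fun t => pruferField p q m n d t (Θ d t)) (a := T₁) (b := T₂)
      (fun t ht => ?_) (hΘ c).continuousOn (fun t ht => (hΘ c).hasDerivWithinAt_Ici ht)
      (fun t ht => ?_) (fun _ _ => mem_univ _) (hΘ d).continuousOn
      (fun t ht => (hΘ d).hasDerivWithinAt_Ici ht) (fun t ht => by simp)
      (fun _ _ => mem_univ _) (by simp [h0]) T₂ (right_mem_Icc.2 hT)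
    · refine LipschitzWith.lipschitzOnWith (LipschitzWith.of_dist_le_mul fun x y => ?_)
      rw [Real.coe_toNNReal _ (by positivity), Real.dist_eq, Real.dist_eq]
      obtain ⟨h1, h2, h3, h4⟩ := hC t (Ico_subset_Icc_self ht)
      exact pruferField_lipschitz h1 h2 h3 h4 d x y
    · rw [Real.dist_eq]
      obtain ⟨h1, h2, h3, h4⟩ := hC t (Ico_subset_Icc_self ht)
      exact abs_pruferField_sub_le h3 h4 c d _
  rw [ContinuousAt, tendsto_iff_dist_tendsto_zero]
  refine squeeze_zero (fun _ => dist_nonneg) hdist ?_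
  have hcont : Continuous fun c =>
      gronwallBound 0 (4 * C * (1 + |d|)).toNNReal (2 * C * |c - d| + 0) (T₂ - T₁) :=
    (gronwallBound_continuous_ε _ _ _).comp (by fun_prop)
  have := hcont.tendsto d
  simpa [gronwallBound_ε0_δ0] using this

/-- A Prüfer angle crosses the multiples of `π` only upwards. -/
theorem IsPruferAngle.int_mul_pi_le (h : IsPruferAngle T₁ T₂ p q m n c θ)
    (hp0 : ∀ t ∈ Icc T₁ T₂, 0 < p t) {s t : ℝ} (hs : T₁ ≤ s) (hst : s ≤ t) (ht : t ≤ T₂) {i : ℤ}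
    (hi : i * Real.pi ≤ θ s) : i * Real.pi ≤ θ t := by
  -- The constant `iπ` is a lower fence: at any contact the angle has slope `1/p > 0`.
  refine image_le_of_deriv_right_lt_deriv_boundary' (f := fun _ => (i : ℝ) * Real.pi)
    (f' := fun _ => 0) (a := s) (b := t) continuousOn_const
    (fun _ _ => hasDerivWithinAt_const _ _ _) hi
    (h.continuousOn.mono (Icc_subset_Icc hs ht))
    (fun r hr => h.hasDerivWithinAt_Ici ⟨hs.trans hr.1, hr.2.trans_le ht⟩) (fun r hr he => ?_)
    (right_mem_Icc.2 hst)
  rw [pruferField_of_sin_eq_zero (by rw [← he]; exact Real.sin_int_mul_pi i)]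
  exact inv_pos.2 (hp0 r ⟨hs.trans hr.1, hr.2.le.trans ht⟩)

/-- If `θ t = iπ`, the slope `1/p > 0` at `t` would force `θ < iπ` just before `t`, against the weak
inequality. Strictness makes each multiple of π attained at most once. -/
theorem IsPruferAngle.int_mul_pi_lt (h : IsPruferAngle T₁ T₂ p q m n c θ)
    (hp0 : ∀ t ∈ Icc T₁ T₂, 0 < p t) {s t : ℝ} (hs : T₁ ≤ s) (hst : s < t) (ht : t ≤ T₂) {i : ℤ}
    (hi : i * Real.pi ≤ θ s) : i * Real.pi < θ t := by
  refine (h.int_mul_pi_le hp0 hs hst.le ht hi).lt_of_ne fun he => ?_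
  have htm : t ∈ Icc T₁ T₂ := ⟨hs.trans hst.le, ht⟩
  have hd := (h t htm).mono (Icc_subset_Icc hs ht)
  rw [pruferField_of_sin_eq_zero (by rw [← he]; exact Real.sin_int_mul_pi i),
    hasDerivWithinAt_iff_tendsto_slope] at hd
  have hpos := hd.eventually (lt_mem_nhds (inv_pos.2 (hp0 t htm)))
  have hne : (𝓝[Icc s t \ {t}] t).NeBot := by
    rw [Icc_sdiff_right]
    exact mem_closure_iff_nhdsWithin_neBot.1 (by
      rw [closure_Ico hst.ne]; exact right_mem_Icc.2 hst.le)
  obtain ⟨r, hr, hrm⟩ := (hpos.and self_mem_nhdsWithin).exists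
  have hrt : r < t := hrm.1.2.lt_of_ne hrm.2
  rw [slope_def_field] at hr
  have h1 := h.int_mul_pi_le hp0 hs hrm.1.1 (hrt.le.trans ht) hi
  exact absurd hr (not_lt.2 (by
    rw [← he]
    exact div_nonpos_of_nonneg_of_nonpos (by linarith) (by linarith)))

/-- The number of zeros of `sin θ` for an angle running from `π/2 + jπ` to `π/2 + (j + k)π`. -/
theorem IsPruferAngle.encard_zeros (h : IsPruferAngle T₁ T₂ p q m n c θ) (hT : T₁ ≤ T₂)
    (hp0 : ∀ t ∈ Icc T₁ T₂, 0 < p t) {j : ℤ} {k : ℕ}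
    (h1 : θ T₁ = Real.pi / 2 + j * Real.pi) (h2 : θ T₂ = Real.pi / 2 + (j + k) * Real.pi) :
    {t ∈ Ioo T₁ T₂ | Real.sin (θ t) = 0}.encard = k := by
  have hpi := Real.pi_pos
  have hinj : InjOn θ {t ∈ Ioo T₁ T₂ | Real.sin (θ t) = 0} := by
    have key : ∀ s ∈ {t ∈ Ioo T₁ T₂ | Real.sin (θ t) = 0}, ∀ t ∈ Ioo T₁ T₂, s < t → θ s < θ t := by
      rintro s ⟨hs, hs0⟩ t ht hst
      obtain ⟨i, hi⟩ := Real.sin_eq_zero_iff.1 hs0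
      rw [← hi]
      exact h.int_mul_pi_lt hp0 hs.1.le hst ht.2.le hi.le
    intro s hs t ht hst
    rcases lt_trichotomy s t with hlt | heq | hlt
    · exact absurd hst (key s hs t ht.1 hlt).ne
    · exact heq
    · exact absurd hst (key t ht s hs.1 hlt).ne'
  -- The multiples of π strictly between the end values are those with index `j + 1, …, j + k`; each
  -- is attained by continuity.
  have himage : θ '' {t ∈ Ioo T₁ T₂ | Real.sin (θ t) = 0} =
      (fun i : ℤ => (i : ℝ) * Real.pi) '' (Finset.Icc (j + 1) (j + k) : Set ℤ) := by
    ext x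
    constructor
    · rintro ⟨t, ⟨ht, ht0⟩, rfl⟩
      obtain ⟨i, hi⟩ := Real.sin_eq_zero_iff.1 ht0
      refine ⟨i, ?_, hi⟩
      have hl : (j : ℝ) * Real.pi < i * Real.pi := by
        rw [hi]
        exact h.int_mul_pi_lt hp0 le_rfl ht.1 ht.2.le (by rw [h1]; linarith)
      have hr : (i : ℝ) * Real.pi < ((j + k + 1 : ℤ) : ℝ) * Real.pi := by
        have := h.int_mul_pi_le hp0 ht.1.le ht.2.le le_rfl hi.le
        rw [h2] at this
        push_cast
        linarith
      have hl' : j < i := by exact_mod_cast lt_of_mul_lt_mul_right hl hpi.le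
      have hr' : i < j + k + 1 := by exact_mod_cast lt_of_mul_lt_mul_right hr hpi.le
      rw [Finset.coe_Icc]
      constructor <;> omega
    · rintro ⟨i, hi, rfl⟩
      rw [Finset.coe_Icc] at hi
      have hl : (j : ℝ) + 1 ≤ i := by exact_mod_cast hi.1
      have hr : (i : ℝ) ≤ j + k := by exact_mod_cast hi.2
      obtain ⟨t, ht, hti⟩ := intermediate_value_Ioo hT h.continuousOn
        (show (i : ℝ) * Real.pi ∈ Ioo (θ T₁) (θ T₂) by
          rw [h1, h2]
          constructor <;> nlinarith)
      exact ⟨t, ⟨ht, by rw [hti]; exact Real.sin_int_mul_pi i⟩, hti⟩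
  rw [← hinj.encard_image, himage, Function.Injective.encard_image, encard_coe_eq_coe_finsetCard]
  · simp
  · intro x y hxy
    exact_mod_cast mul_right_cancel₀ hpi.ne' hxy

/-- For the parameter `0` an angle starting at `π/2 + jπ` does not increase by more than `π`. -/
theorem IsPruferAngle.terminal_le_of_zero (h : IsPruferAngle T₁ T₂ p q m n 0 θ) (hT : T₁ ≤ T₂)
    (hq0 : ∀ t ∈ Icc T₁ T₂, 0 ≤ q t) {C : ℝ}
    (hC : ∀ t ∈ Icc T₁ T₂, |(p t)⁻¹| ≤ C ∧ |q t| ≤ C ∧ |m t| ≤ C ∧ |n t| ≤ C)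
    (h1 : Real.cos (θ T₁) = 0) : θ T₂ ≤ θ T₁ + Real.pi := by
  -- Upper fence `θ T₁ + ε exp (K (t - T₁))`: since `cos (θ T₁) = 0`, the field at `θ T₁` is `-q
  -- sin² ≤ 0`, and `K` exceeds the Lipschitz constant `4 * C`. This `ε` makes the fence end at `θ
  -- T₁ + π`, which is enough because only `k ≥ 1` is needed.
  set K := 4 * C + 1 with hK
  set ε := Real.pi * Real.exp (-(K * (T₂ - T₁))) with hε
  have hε0 : 0 < ε := mul_pos Real.pi_pos (Real.exp_pos _)
  have hB : ∀ t, HasDerivAt (fun t => θ T₁ + ε * Real.exp (K * (t - T₁)))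
      (ε * (Real.exp (K * (t - T₁)) * K)) t := by
    intro t
    have h2 : HasDerivAt (fun t => K * (t - T₁)) K t := by
      simpa using ((hasDerivAt_id t).sub_const T₁).const_mul K
    simpa using ((h2.exp.const_mul ε).const_add (θ T₁))
  have := image_le_of_deriv_right_lt_deriv_boundary' (f := θ)
    (f' := fun t => pruferField p q m n 0 t (θ t)) (a := T₁) (b := T₂) h.continuousOn
    (fun r hr => h.hasDerivWithinAt_Ici hr)
    (B := fun t => θ T₁ + ε * Real.exp (K * (t - T₁)))
    (B' := fun t => ε * (Real.exp (K * (t - T₁)) * K)) (by simp [hε0.le])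
    (fun t _ => (hB t).continuousAt.continuousWithinAt) (fun t _ => (hB t).hasDerivWithinAt)
    (fun t ht he => ?_) (right_mem_Icc.2 hT)
  · refine this.trans_eq ?_
    simp only [hε, mul_assoc, ← Real.exp_add]
    simp
  · obtain ⟨b1, b2, b3, b4⟩ := hC t (Ico_subset_Icc_self ht)
    have hlip := pruferField_lipschitz b1 b2 b3 b4 0 (θ t) (θ T₁)
    have hz : pruferField p q m n 0 t (θ T₁) ≤ 0 := by
      simp only [pruferField, h1]
      have := mul_nonneg (hq0 t (Ico_subset_Icc_self ht)) (sq_nonneg (Real.sin (θ T₁)))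
      nlinarith
    have hE : 0 < ε * Real.exp (K * (t - T₁)) := mul_pos hε0 (Real.exp_pos _)
    have hd : |θ t - θ T₁| = ε * Real.exp (K * (t - T₁)) := by
      rw [he, add_sub_cancel_left, abs_of_pos hE]
    rw [hd, abs_zero, add_zero, mul_one] at hlip
    have := (le_abs_self _).trans hlip
    calc _ ≤ 4 * C * (ε * Real.exp (K * (t - T₁))) := by linarith
      _ < K * (ε * Real.exp (K * (t - T₁))) := by
        exact mul_lt_mul_of_pos_right (by linarith) hE
      _ = _ := by ring

/-- The time needed by an angle with speed `κ cos² + Λ sin²` to make half a turn tends to `0` as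
`Λ → ∞`. -/
theorem tendsto_half_turn_time {κ : ℝ} (hκ : 0 < κ) :
    Tendsto (fun Λ : ℝ => ∫ x in (0 : ℝ)..Real.pi,
      (κ * Real.cos x ^ 2 + Λ * Real.sin x ^ 2)⁻¹) atTop (𝓝 0) := by
  have hpos : ∀ Λ : ℝ, 1 ≤ Λ → ∀ x, min κ 1 ≤ κ * Real.cos x ^ 2 + Λ * Real.sin x ^ 2 := by
    intro Λ hΛ x
    have h1 := Real.sin_sq_add_cos_sq x
    nlinarith [min_le_left κ 1, min_le_right κ 1, sq_nonneg (Real.cos x), sq_nonneg (Real.sin x)]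
  have hmin : 0 < min κ 1 := lt_min hκ one_pos
  have := intervalIntegral.tendsto_integral_filter_of_dominated_convergence
    (μ := MeasureTheory.volume) (a := 0) (b := Real.pi) (l := atTop)
    (F := fun (Λ : ℝ) x => (κ * Real.cos x ^ 2 + Λ * Real.sin x ^ 2)⁻¹) (f := fun _ => (0 : ℝ))
    (fun _ => (min κ 1)⁻¹) ?_ ?_ ?_ ?_
  · simpa using this
  · filter_upwards with Λ
    exact (by fun_prop : Measurable fun x =>
      (κ * Real.cos x ^ 2 + Λ * Real.sin x ^ 2)⁻¹).aestronglyMeasurable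
  · filter_upwards [eventually_ge_atTop 1] with Λ hΛ
    refine Eventually.of_forall fun x _ => ?_
    rw [Real.norm_eq_abs, abs_of_pos (inv_pos.2 (hmin.trans_le (hpos Λ hΛ x)))]
    exact inv_anti₀ hmin (hpos Λ hΛ x)
  · exact intervalIntegrable_const
  · have hae : ∀ᵐ x : ℝ, x ≠ Real.pi := by simp [MeasureTheory.ae_iff]
    filter_upwards [hae] with x hx hxm
    rw [uIoc_of_le Real.pi_pos.le] at hxm
    have hs : 0 < Real.sin x := Real.sin_pos_of_pos_of_lt_pi hxm.1 (hxm.2.lt_of_ne hx)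
    refine tendsto_inv_atTop_zero.comp (tendsto_atTop_add_const_left _ _ ?_)
    exact tendsto_id.atTop_mul_const (pow_pos hs 2)

/-- If both weights are positive on a subinterval, the angle grows there by any prescribed amount
for large values of the parameter. -/
theorem exists_large_growth (hT : T₁ ≤ T₂) {C κ δ s r : ℝ} (hκ : 0 < κ) (hδ : 0 < δ) (hs : T₁ ≤ s)
    (hsr : s < r) (hr : r ≤ T₂) (hpκ : ∀ t ∈ Icc T₁ T₂, κ ≤ (p t)⁻¹)
    (hq : ∀ t ∈ Icc T₁ T₂, |q t| ≤ C) (hm : ∀ t ∈ Icc s r, δ ≤ m t) (hn : ∀ t ∈ Icc s r, δ ≤ n t)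
    (K : ℕ) :
    ∃ c, 0 ≤ c ∧ ∀ θ, IsPruferAngle T₁ T₂ p q m n c θ → θ s + K * Real.pi ≤ θ r := by
  have hC0 : 0 ≤ C := (abs_nonneg _).trans (hq T₁ (left_mem_Icc.2 hT))
  -- `Λ` is chosen so large that `K` half turns take less time than `r - s`.
  have htend := (tendsto_half_turn_time hκ).const_mul (K : ℝ)
  rw [mul_zero] at htend
  obtain ⟨Λ, hΛlt, hΛ1⟩ := ((htend.eventually (gt_mem_nhds (sub_pos.2 hsr))).and
    (eventually_ge_atTop 1)).exists
  set g : ℝ → ℝ := fun x => (κ * Real.cos x ^ 2 + Λ * Real.sin x ^ 2)⁻¹ with hg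
  have hden : ∀ x, 0 < κ * Real.cos x ^ 2 + Λ * Real.sin x ^ 2 := by
    intro x
    have h1 := Real.sin_sq_add_cos_sq x
    have hmin : 0 < min κ 1 := lt_min hκ one_pos
    nlinarith [min_le_left κ 1, min_le_right κ 1, sq_nonneg (Real.cos x), sq_nonneg (Real.sin x)]
  have hgc : Continuous g := by
    refine Continuous.inv₀ (by fun_prop) fun x => (hden x).ne'
  have hper : Function.Periodic g Real.pi := by
    intro x
    simp only [hg, Real.cos_add_pi, Real.sin_add_pi, neg_sq]
  have hgint : ∀ x y, IntervalIntegrable g MeasureTheory.volume x y := fun x y =>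
    hgc.intervalIntegrable x y
  -- With this parameter, `c * δ = Λ + C`: the part `C` absorbs `-q`, leaving speed at least `κ cos²
  -- + Λ sin²`.
  refine ⟨(Λ + C) / δ, by positivity, fun θ h => ?_⟩
  by_contra! hcon
  set c := (Λ + C) / δ with hc
  have hc0 : 0 ≤ c := by positivity
  -- Separation of variables: `g` is the reciprocal of the minimal speed, so its primitive along `θ`
  -- grows at least as fast as time.
  have hmono : MonotoneOn (fun t => (∫ x in (0 : ℝ)..θ t, g x) - t) (Icc s r) := by
    have hderiv : ∀ t ∈ Ioo s r, HasDerivAt (fun t => (∫ x in (0 : ℝ)..θ t, g x) - t)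
        (g (θ t) * pruferField p q m n c t (θ t) - 1) t := by
      intro t ht
      have htm : t ∈ Icc T₁ T₂ := ⟨hs.trans ht.1.le, ht.2.le.trans hr⟩
      have h1 : HasDerivAt θ (pruferField p q m n c t (θ t)) t :=
        (h t htm).hasDerivAt (Icc_mem_nhds (hs.trans_lt ht.1) (ht.2.trans_le hr))
      have h2 : HasDerivAt (fun y => ∫ x in (0 : ℝ)..y, g x) (g (θ t)) (θ t) :=
        intervalIntegral.integral_hasDerivAt_right (hgint _ _)
          (hgc.stronglyMeasurableAtFilter _ _) hgc.continuousAt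
      exact (h2.comp t h1).sub (hasDerivAt_id t)
    apply monotoneOn_of_deriv_nonneg (convex_Icc s r)
    · refine ContinuousOn.sub ?_ continuousOn_id
      exact (intervalIntegral.continuous_primitive hgint 0).comp_continuousOn
        (h.continuousOn.mono (Icc_subset_Icc hs hr))
    · rw [interior_Icc]
      exact fun t ht => (hderiv t ht).differentiableAt.differentiableWithinAt
    · rw [interior_Icc]
      intro t ht
      rw [(hderiv t ht).deriv, sub_nonneg]
      have htm : t ∈ Icc T₁ T₂ := ⟨hs.trans ht.1.le, ht.2.le.trans hr⟩
      have hspeed : κ * Real.cos (θ t) ^ 2 + Λ * Real.sin (θ t) ^ 2 ≤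
          pruferField p q m n c t (θ t) := by
        have e0 : Real.sin (θ t) ^ 2 = (Real.sin (θ t))⁺ ^ 2 + (Real.sin (θ t))⁻ ^ 2 := by
          rcases le_total 0 (Real.sin (θ t)) with h0 | h0
          · simp [posPart_of_nonneg h0, negPart_of_nonneg h0]
          · simp [posPart_of_nonpos h0, negPart_of_nonpos h0]
        have e1 := mul_le_mul_of_nonneg_right (hpκ t htm) (sq_nonneg (Real.cos (θ t)))
        have e2 := mul_le_mul_of_nonneg_right ((le_abs_self _).trans (hq t htm))
          (sq_nonneg (Real.sin (θ t)))
        have e3 := mul_le_mul_of_nonneg_right (hm t (Ioo_subset_Icc_self ht))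
          (sq_nonneg (Real.sin (θ t))⁺)
        have e4 := mul_le_mul_of_nonneg_right (hn t (Ioo_subset_Icc_self ht))
          (sq_nonneg (Real.sin (θ t))⁻)
        have e5 : c * (δ * Real.sin (θ t) ^ 2) ≤
            c * (m t * (Real.sin (θ t))⁺ ^ 2 + n t * (Real.sin (θ t))⁻ ^ 2) :=
          mul_le_mul_of_nonneg_left (by rw [e0]; linarith) hc0
        have e6 : c * (δ * Real.sin (θ t) ^ 2) = (Λ + C) * Real.sin (θ t) ^ 2 := by
          rw [hc]; field_simp
        rw [pruferField]
        linarith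
      calc (1 : ℝ) = g (θ t) * (κ * Real.cos (θ t) ^ 2 + Λ * Real.sin (θ t) ^ 2) :=
            (inv_mul_cancel₀ (hden _).ne').symm
        _ ≤ _ := mul_le_mul_of_nonneg_left hspeed (inv_pos.2 (hden _)).le
  have h1 := hmono (left_mem_Icc.2 hsr.le) (right_mem_Icc.2 hsr.le) hsr.le
  simp only at h1
  -- If the growth were below `Kπ`, then `r - s ≤ ∫ g` from `θ s` to `θ r`, which is at most `K`
  -- times the integral over one period, hence less than `r - s`.
  have h2 := intervalIntegral.integral_add_adjacent_intervals (hgint 0 (θ r))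
    (hgint (θ r) (θ s + K * Real.pi))
  have h3 := intervalIntegral.integral_add_adjacent_intervals (hgint 0 (θ s))
    (hgint (θ s) (θ s + K * Real.pi))
  have h4 : 0 ≤ ∫ x in θ r..θ s + K * Real.pi, g x :=
    intervalIntegral.integral_nonneg hcon.le fun x _ => (inv_pos.2 (hden x)).le
  have h5 : ∫ x in θ s..θ s + K * Real.pi, g x = K * ∫ x in (0 : ℝ)..Real.pi, g x := by
    have := hper.intervalIntegral_add_zsmul_eq K (θ s) hgint
    rw [hper.intervalIntegral_add_eq (θ s) 0, zero_add] at this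
    simpa using this
  linarith

/-- The solution `u = r sin θ` built from a Prüfer angle. -/
theorem IsPruferAngle.exists_solution (h : IsPruferAngle T₁ T₂ p q m n c θ) (hT : T₁ < T₂)
    (hp : ContinuousOn p (Icc T₁ T₂))
    (hq : ContinuousOn q (Icc T₁ T₂)) (hm : ContinuousOn m (Icc T₁ T₂))
    (hn : ContinuousOn n (Icc T₁ T₂)) (hp0 : ∀ t ∈ Icc T₁ T₂, 0 < p t)
    (h1 : Real.cos (θ T₁) = 0) (h2 : Real.cos (θ T₂) = 0) :
    ∃ ρ : ℝ → ℝ, (∀ t, 0 < ρ t) ∧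
      IsNeumannSolution T₁ T₂ p q m n c c (fun t => ρ t * Real.sin (θ t)) := by
  have hθ := h.continuousOn
  -- The logarithmic derivative of `ρ` forced by `u = ρ sin θ`, `p u' = ρ cos θ`.
  set R : ℝ → ℝ := fun t => (p t)⁻¹ * (Real.sin (θ t) * Real.cos (θ t)) + Real.cos (θ t) *
    (q t * Real.sin (θ t) - c * (m t * (Real.sin (θ t))⁺ - n t * (Real.sin (θ t))⁻)) with hR
  have hRc : ContinuousOn R (Icc T₁ T₂) := by
    have e1 : ContinuousOn (fun t => (Real.sin (θ t))⁺) (Icc T₁ T₂) :=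
      continuous_posPart.comp_continuousOn (by fun_prop)
    have e2 : ContinuousOn (fun t => (Real.sin (θ t))⁻) (Icc T₁ T₂) :=
      continuous_negPart.comp_continuousOn (by fun_prop)
    refine ContinuousOn.add ((hp.inv₀ fun t ht => (hp0 t ht).ne').mul ?_) ?_ <;> fun_prop
  -- Extending `R` continuously to the line makes its primitive differentiable at the end points
  -- too.
  set E : ℝ → ℝ := IccExtend hT.le (domRestrict (Icc T₁ T₂) R) with hE
  have hEc : Continuous E := hRc.domRestrict.Icc_extend'
  have hER : ∀ t ∈ Icc T₁ T₂, E t = R t := fun t ht => by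
    rw [hE, IccExtend_of_mem hT.le _ ht, domRestrict_apply]
  set ρ : ℝ → ℝ := fun t => Real.exp (∫ x in T₁..t, E x) with hρ
  have hρd : ∀ t, HasDerivAt ρ (ρ t * E t) t := fun t =>
    (intervalIntegral.integral_hasDerivAt_right (hEc.intervalIntegrable _ _)
      (hEc.stronglyMeasurableAtFilter _ _) hEc.continuousAt).exp
  have hpyth : ∀ t, Real.sin (θ t) ^ 2 + Real.cos (θ t) ^ 2 = 1 := fun t =>
    Real.sin_sq_add_cos_sq _
  have hu : ∀ t ∈ Icc T₁ T₂, HasDerivWithinAt (fun t => ρ t * Real.sin (θ t))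
      ((p t)⁻¹ * (ρ t * Real.cos (θ t))) (Icc T₁ T₂) t := by
    intro t ht
    refine ((hρd t).hasDerivWithinAt.mul (h t ht).sin).congr_deriv ?_
    rw [hER t ht, hR, pruferField]
    rcases le_total 0 (Real.sin (θ t)) with h0 | h0
    · simp only [posPart_of_nonneg h0, negPart_of_nonneg h0]
      linear_combination ρ t * (p t)⁻¹ * Real.cos (θ t) * hpyth t
    · simp only [posPart_of_nonpos h0, negPart_of_nonpos h0]
      linear_combination ρ t * (p t)⁻¹ * Real.cos (θ t) * hpyth t
  have hv : ∀ t ∈ Icc T₁ T₂, HasDerivWithinAt (fun t => ρ t * Real.cos (θ t))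
      (q t * (ρ t * Real.sin (θ t)) - (c * m t * (ρ t * Real.sin (θ t))⁺
        - c * n t * (ρ t * Real.sin (θ t))⁻)) (Icc T₁ T₂) t := by
    intro t ht
    refine ((hρd t).hasDerivWithinAt.mul (h t ht).cos).congr_deriv ?_
    rw [hER t ht, hR, pruferField]
    have hρ0 : 0 ≤ ρ t := (Real.exp_pos _).le
    rcases le_total 0 (Real.sin (θ t)) with h0 | h0
    · have h0' := mul_nonneg hρ0 h0
      simp only [posPart_of_nonneg h0, negPart_of_nonneg h0, posPart_of_nonneg h0',
        negPart_of_nonneg h0']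
      linear_combination ρ t * (q t - c * m t) * Real.sin (θ t) * hpyth t
    · have h0' := mul_nonpos_of_nonneg_of_nonpos hρ0 h0
      simp only [posPart_of_nonpos h0, negPart_of_nonpos h0, posPart_of_nonpos h0',
        negPart_of_nonpos h0']
      linear_combination ρ t * (q t - c * n t) * Real.sin (θ t) * hpyth t
  have hud := uniqueDiffOn_Icc hT
  have hD : ∀ t ∈ Icc T₁ T₂, derivWithin (fun t => ρ t * Real.sin (θ t)) (Icc T₁ T₂) t =
      (p t)⁻¹ * (ρ t * Real.cos (θ t)) := fun t ht => (hu t ht).derivWithin (hud t ht)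
  refine ⟨ρ, fun t => Real.exp_pos _, ?_, ?_, ?_, ?_⟩
  · rw [contDiffOn_one_iff_derivWithin hud]
    refine ⟨fun t ht => (hu t ht).differentiableWithinAt, ContinuousOn.congr ?_ hD⟩
    exact (hp.inv₀ fun t ht => (hp0 t ht).ne').mul fun t ht => (hv t ht).continuousWithinAt
  · intro t ht
    have hnhds := Icc_mem_nhds ht.1 ht.2
    refine ((hv t (Ioo_subset_Icc_self ht)).hasDerivAt hnhds).congr_of_eventuallyEq ?_
    filter_upwards [hnhds] with s hs
    rw [hD s hs, mul_inv_cancel_left₀ (hp0 s hs).ne']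
  · rw [hD T₁ (left_mem_Icc.2 hT.le), h1]; simp
  · rw [hD T₂ (right_mem_Icc.2 hT.le), h2]; simp

end angle

/-! ### Shooting along the ray, and the theorem -/

theorem cos_half_pi_add_int_mul_pi (j : ℤ) : Real.cos (Real.pi / 2 + j * Real.pi) = 0 := by
  rw [Real.cos_add_int_mul_pi]; simp

/-- If `m` and `n` are positive at a common point, then for each `k ≥ 1` and `j` there are a
parameter `c ≥ 0` and a solution for `(c, c)` with `k` interior zeros whose sign at `T₂` is that of
`sin (π/2 + (j + k)π)`. -/
theorem exists_solution_on_ray {T₁ T₂ : ℝ} (hT : T₁ < T₂) {p q m n : ℝ → ℝ}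
    (hp : ContinuousOn p (Icc T₁ T₂)) (hq : ContinuousOn q (Icc T₁ T₂))
    (hm : ContinuousOn m (Icc T₁ T₂)) (hn : ContinuousOn n (Icc T₁ T₂))
    (hp0 : ∀ t ∈ Icc T₁ T₂, 0 < p t) (hq0 : ∀ t ∈ Icc T₁ T₂, 0 ≤ q t)
    {t₀ : ℝ} (ht₀ : t₀ ∈ Icc T₁ T₂) (hm0 : 0 < m t₀) (hn0 : 0 < n t₀) {k : ℕ} (hk : 1 ≤ k)
    (j : ℤ) :
    ∃ c, 0 ≤ c ∧ ∃ u, IsNeumannSolution T₁ T₂ p q m n c c u ∧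
      {t ∈ Ioo T₁ T₂ | u t = 0}.encard = k ∧
      ∃ ρ > 0, u T₂ = ρ * Real.sin (Real.pi / 2 + (j + k) * Real.pi) := by
  have hpi := Real.pi_pos
  obtain ⟨C₁, hC₁⟩ := isCompact_Icc.exists_bound_of_continuousOn
    (hp.inv₀ fun t ht => (hp0 t ht).ne')
  obtain ⟨C₂, hC₂⟩ := isCompact_Icc.exists_bound_of_continuousOn hq
  obtain ⟨C₃, hC₃⟩ := isCompact_Icc.exists_bound_of_continuousOn hm
  obtain ⟨C₄, hC₄⟩ := isCompact_Icc.exists_bound_of_continuousOn hn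
  obtain ⟨C₅, hC₅⟩ := isCompact_Icc.exists_bound_of_continuousOn hp
  set C := max (max C₁ C₂) (max C₃ C₄)
  have hC : ∀ t ∈ Icc T₁ T₂, |(p t)⁻¹| ≤ C ∧ |q t| ≤ C ∧ |m t| ≤ C ∧ |n t| ≤ C := fun t ht =>
    ⟨(hC₁ t ht).trans ((le_max_left _ _).trans (le_max_left _ _)),
      (hC₂ t ht).trans ((le_max_right _ _).trans (le_max_left _ _)),
      (hC₃ t ht).trans ((le_max_left _ _).trans (le_max_right _ _)),
      (hC₄ t ht).trans ((le_max_right _ _).trans (le_max_right _ _))⟩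
  have hp5 : ∀ t ∈ Icc T₁ T₂, p t ≤ C₅ := fun t ht => (le_abs_self _).trans (hC₅ t ht)
  have hC5 : 0 < C₅ := (hp0 t₀ ht₀).trans_le (hp5 t₀ ht₀)
  -- a subinterval on which both weights are bounded below
  obtain ⟨δ, hδ, s, r, hs, hsr, hr, hms, hns⟩ : ∃ δ > 0, ∃ s r, T₁ ≤ s ∧ s < r ∧ r ≤ T₂ ∧
      (∀ t ∈ Icc s r, δ ≤ m t) ∧ ∀ t ∈ Icc s r, δ ≤ n t := by
    have hev : ∀ᶠ t in 𝓝[Icc T₁ T₂] t₀, m t₀ / 2 < m t ∧ n t₀ / 2 < n t :=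
      ((hm t₀ ht₀).eventually (lt_mem_nhds (half_lt_self hm0))).and
        ((hn t₀ ht₀).eventually (lt_mem_nhds (half_lt_self hn0)))
    obtain ⟨ε, hε, hball⟩ := Metric.mem_nhdsWithin_iff.1 hev
    -- The clipping by `max` and `min` also covers the case where `t₀` is an end point.
    have hin : ∀ t ∈ Icc (max T₁ (t₀ - ε / 2)) (min T₂ (t₀ + ε / 2)),
        m t₀ / 2 < m t ∧ n t₀ / 2 < n t := fun t ht => hball (by
      have h1 := max_le_iff.1 ht.1
      have h2 := le_min_iff.1 ht.2
      refine ⟨?_, h1.1, h2.1⟩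
      rw [Metric.mem_ball, Real.dist_eq, abs_lt]
      constructor <;> linarith)
    refine ⟨min (m t₀ / 2) (n t₀ / 2), lt_min (half_pos hm0) (half_pos hn0), _, _,
      le_max_left _ _, ?_, min_le_left _ _, fun t ht => (min_le_left _ _).trans (hin t ht).1.le,
      fun t ht => (min_le_right _ _).trans (hin t ht).2.le⟩
    have h1 := ht₀.1
    have h2 := ht₀.2
    refine max_lt (lt_min hT (by linarith)) (lt_min (by linarith) (by linarith))
  -- One half turn more than `k`: before `s` the angle may drop, but not below `jπ`; it is then at
  -- least `(j + k + 1)π` at `r` and stays so up to `T₂`.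
  obtain ⟨Λ, hΛ0, hΛ⟩ := exists_large_growth hT.le (inv_pos.2 hC5) hδ hs hsr hr
    (fun t ht => inv_anti₀ (hp0 t ht) (hp5 t ht)) (fun t ht => (hC t ht).2.1) hms hns (k + 1)
  choose Θ hΘ0 hΘ using fun c => exists_isPruferAngle hT.le hp hq hm hn hp0 hC c
    (Real.pi / 2 + j * Real.pi)
  have hcont := continuous_terminal_angle hT.le hC hΘ0 hΘ
  have hk' : (1 : ℝ) ≤ k := by exact_mod_cast hk
  have hlow : Θ 0 T₂ ≤ Real.pi / 2 + (j + k) * Real.pi := by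
    have := (hΘ 0).terminal_le_of_zero hT.le hq0 hC
      (by rw [hΘ0]; exact cos_half_pi_add_int_mul_pi j)
    rw [hΘ0] at this
    nlinarith
  have hhigh : Real.pi / 2 + (j + k) * Real.pi ≤ Θ Λ T₂ := by
    have e1 : (j : ℝ) * Real.pi ≤ Θ Λ s :=
      (hΘ Λ).int_mul_pi_le hp0 le_rfl hs (hsr.le.trans hr) (by rw [hΘ0]; linarith)
    have e2 := hΛ _ (hΘ Λ)
    have e3 := (hΘ Λ).int_mul_pi_le hp0 (hs.trans hsr.le) hr le_rfl (i := j + k + 1) (by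
      push_cast at e2 ⊢
      linarith)
    push_cast at e3
    linarith
  -- Only continuity in `c` is used; for weights of variable sign the terminal angle need not be
  -- monotone.
  obtain ⟨c, hc, hcT⟩ := intermediate_value_Icc hΛ0 hcont.continuousOn ⟨hlow, hhigh⟩
  simp only at hcT
  obtain ⟨ρ, hρ, hsol⟩ := (hΘ c).exists_solution hT hp hq hm hn hp0
    (by rw [hΘ0]; exact cos_half_pi_add_int_mul_pi j)
    (by rw [hcT]; exact_mod_cast cos_half_pi_add_int_mul_pi (j + k))
  refine ⟨c, hc.1, _, hsol, ?_, ρ T₂, hρ T₂, by rw [hcT]⟩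
  rw [← (hΘ c).encard_zeros hT.le hp0 (hΘ0 c) hcT]
  congr 1
  ext t
  simp [(hρ t).ne']

theorem theorem4 (T₁ T₂ : ℝ) (hT : T₁ < T₂) (p q m n : ℝ → ℝ)
    (hp : ContinuousOn p (Icc T₁ T₂)) (hq : ContinuousOn q (Icc T₁ T₂))
    (hm : ContinuousOn m (Icc T₁ T₂)) (hn : ContinuousOn n (Icc T₁ T₂))
    (hp_pos : ∀ t ∈ Icc T₁ T₂, 0 < p t) (hq_nonneg : ∀ t ∈ Icc T₁ T₂, 0 ≤ q t)
    (hm_ne : ∃ t ∈ Icc T₁ T₂, m t ≠ 0) (hn_ne : ∃ t ∈ Icc T₁ T₂, n t ≠ 0)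
    (ε₁ ε₂ : ℤˣ) :
    ((∃ t ∈ Icc T₁ T₂, signPart ε₁ m t * signPart ε₂ n t ≠ 0) →
      ∀ k : ℕ, 1 ≤ k →
        (curveGT T₁ T₂ p q m n k ∩ quadrant ε₁ ε₂).Nonempty ∧
        (curveLT T₁ T₂ p q m n k ∩ quadrant ε₁ ε₂).Nonempty) ∧
    ((bumps T₁ T₂ (signPart ε₁ m)).Finite ∨ (bumps T₁ T₂ (signPart ε₂ n)).Finite →
      ((∀ k : ℕ, 1 ≤ k →
          (curveGT T₁ T₂ p q m n k ∩ quadrant ε₁ ε₂).Nonempty ∧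
          (curveLT T₁ T₂ p q m n k ∩ quadrant ε₁ ε₂).Nonempty) →
        ∃ t ∈ Icc T₁ T₂, signPart ε₁ m t * signPart ε₂ n t ≠ 0) ∧
      ({k : ℕ | 1 ≤ k ∧
          ((curveGT T₁ T₂ p q m n k ∩ quadrant ε₁ ε₂).Nonempty ∨
            (curveLT T₁ T₂ p q m n k ∩ quadrant ε₁ ε₂).Nonempty)}.Infinite →
        ∃ t ∈ Icc T₁ T₂, signPart ε₁ m t * signPart ε₂ n t ≠ 0)) := by
  constructor
  · rintro ⟨t₀, ht₀, hne⟩ k hk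
    have hm0 : 0 < ((ε₁ : ℤ) : ℝ) * m t₀ := by
      rw [← posPart_pos_iff]
      exact (posPart_nonneg _).lt_of_ne' (left_ne_zero_of_mul hne)
    have hn0 : 0 < ((ε₂ : ℤ) : ℝ) * n t₀ := by
      rw [← posPart_pos_iff]
      exact (posPart_nonneg _).lt_of_ne' (right_ne_zero_of_mul hne)
    have hsq : ∀ ε : ℤˣ, ((ε : ℤ) : ℝ) * ((ε : ℤ) : ℝ) = 1 := fun ε => by
      rcases Int.units_eq_one_or ε with rfl | rfl <;> simp
    have key := exists_solution_on_ray hT hp hq (hm.const_smul ((ε₁ : ℤ) : ℝ))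
      (hn.const_smul ((ε₂ : ℤ) : ℝ)) hp_pos hq_nonneg ht₀ hm0 hn0 hk
    have hconv : ∀ c u, IsNeumannSolution T₁ T₂ p q (fun t => ((ε₁ : ℤ) : ℝ) • m t)
        (fun t => ((ε₂ : ℤ) : ℝ) • n t) c c u →
        IsNeumannSolution T₁ T₂ p q m n (ε₁ * c) (ε₂ * c) u := fun c u h =>
      { h with
        equation := fun t ht => (h.equation t ht).congr_deriv (by
          simp only [smul_eq_mul]; ring) }
    have hquad : ∀ c : ℝ, 0 ≤ c → ((ε₁ * c, ε₂ * c) : ℝ × ℝ) ∈ quadrant ε₁ ε₂ := fun c hc => by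
      constructor
      · show 0 ≤ ((ε₁ : ℤ) : ℝ) * (ε₁ * c)
        rwa [← mul_assoc, hsq, one_mul]
      · show 0 ≤ ((ε₂ : ℤ) : ℝ) * (ε₂ * c)
        rwa [← mul_assoc, hsq, one_mul]
    constructor
    -- With `j = -k` the terminal angle is π/2, where the sine is 1.
    · obtain ⟨c, hc, u, hu, hz, ρ, hρ, hend⟩ := key (-k)
      refine ⟨_, ⟨u, hconv c u hu, hz, ?_⟩, hquad c hc⟩
      rw [hend]
      simpa using hρ
    -- With `j = 1 - k` it is 3π/2, where the sine is -1.
    · obtain ⟨c, hc, u, hu, hz, ρ, hρ, hend⟩ := key (1 - k)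
      refine ⟨_, ⟨u, hconv c u hu, hz, ?_⟩, hquad c hc⟩
      rw [hend]
      simpa [Real.sin_add_pi] using hρ
  · intro hfin
    have hinf : {k : ℕ | 1 ≤ k ∧
          ((curveGT T₁ T₂ p q m n k ∩ quadrant ε₁ ε₂).Nonempty ∨
            (curveLT T₁ T₂ p q m n k ∩ quadrant ε₁ ε₂).Nonempty)}.Infinite →
        ∃ t ∈ Icc T₁ T₂, signPart ε₁ m t * signPart ε₂ n t ≠ 0 := by
      intro hI
      by_contra! hzero
      obtain ⟨k, ⟨-, hk⟩, hlt⟩ := hI.exists_gt (2 * (bumps T₁ T₂ (signPart ε₁ m)).ncard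
        + 2 * (bumps T₁ T₂ (signPart ε₂ n)).ncard + 4)
      rcases hk with ⟨⟨a, b⟩, ⟨u, hu, hz, -⟩, hab⟩ | ⟨⟨a, b⟩, ⟨u, hu, hz, -⟩, hab⟩ <;>
      exact lt_asymm hlt
        (hu.zeros_le hp hq hm hn hp_pos hq_nonneg hab hzero hfin hz)
    exact ⟨fun hall => hinf ((Ici_infinite 1).mono fun k hk => ⟨hk, Or.inl (hall k hk).1⟩), hinf⟩
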